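/- Let $N\ge 0$ be an integer and let $a_0,\dots,a_N,b_0,\dots,b_N$ be mutually independent real random variables on a probability space, each normally distributed with mean $0$ and variance $1$. Put $\eta_j=a_j+ib_j$ and $$S_N(z)=\sum_{j=0}^N\eta_j z^j\qquad(z\in\mathbb C).$$ For $\mathbf K=(K_1,K_2)\in\mathbb R^2$ and compact $\Phi\subset\mathbb C$ let $\nu_{N,\mathbf K}(\Phi)$ be the number of $z\in\Phi$ with $S_N(z)=K_1+iK_2$. Then there is exactly one continuous function $h_{N,\mathbf K}:\mathbb C\to[0,\infty)$ (the expected density of the complex zeros of the random equation $S_N(z)=\mathbf K$) such that $$\mathbb E\,\nu_{N,\mathbf K}(\Phi)=\int_\Phi h_{N,\mathbf K}(z)\,dz\qquad\text{for every compact }\Phi\subset\mathbb C,$$ where $dz$ is the area measure, and $$h_{N,\mathbf K}(\pm1)=\frac1{12\pi}\,e^{-(K_1^2+K_2^2)/(2N+2)}\left\{2N+N^2\left(1+\frac{3(K_1^2+K_2^2)}{2N+2}\right)\right\}.$$ In particular, if $K>0$ and $K_1^2+K_2^2=2K^2$ (for instance $K_1=K_2=K$), then $$h_{N,\mathbf K}(\pm1)=\frac1{12\pi}\,e^{-K^2/(N+1)}\left\{2N+N^2\left(1+\frac{3K^2}{N+1}\right)\right\},$$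 and for $\mathbf K=\mathbf 0$ $$h_{N,\mathbf 0}(\pm1)=\frac1{12\pi}\,N(N+2).$$ -/

import Mathlib

open MeasureTheory ProbabilityTheory
open scoped ENNReal

/-- `a₀, …, a_N, b₀, …, b_N` are mutually independent real random variables on `(Ω, P)`, each
normally distributed with mean zero and variance one. -/
structure IsStdGaussianCoeffs {Ω : Type*} [MeasurableSpace Ω] (P : Measure Ω) {N : ℕ}
    (a b : Fin (N + 1) → Ω → ℝ) : Prop where
  law_a : ∀ j, HasLaw (a j) (gaussianReal 0 1) P
  law_b : ∀ j, HasLaw (b j) (gaussianReal 0 1) P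
  indep : iIndepFun (Sum.elim a b) P

/-- The random sum `S_N(z) = ∑_{j=0}^N η_j f_j(z)` with `η_j = a_j + i b_j`. -/
noncomputable def randomSum {Ω : Type*} {N : ℕ} (f : Fin (N + 1) → ℂ → ℂ)
    (a b : Fin (N + 1) → Ω → ℝ) (ω : Ω) (z : ℂ) : ℂ :=
  ∑ j, ((a j ω : ℂ) + Complex.I * (b j ω : ℂ)) * f j z

/-- The number `ν_K(Φ)` of points of `Φ` at which `S` takes the value `K` (possibly infinite). -/
noncomputable def levelCount (S : ℂ → ℂ) (K : ℂ) (Φ : Set ℂ) : ℝ≥0∞ :=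
  ((({z ∈ Φ | S z = K}.encard) : ℕ∞) : ℝ≥0∞)

/-- `h` is the (continuous) expected density of the solutions `z` of the random equation
`S ω z = K`: for every compact `Φ ⊆ ℂ` the number of solutions in `Φ` is a random variable, whose
expectation is the integral of `h` over `Φ` with respect to the area measure. -/
structure IsExpectedZeroDensity {Ω : Type*} [MeasurableSpace Ω] (P : Measure Ω)
    (S : Ω → ℂ → ℂ) (K : ℂ) (h : ℂ → ℝ) : Prop where
  continuous : Continuous h
  nonneg : ∀ z, 0 ≤ h z
  aemeasurable_count : ∀ Φ : Set ℂ, IsCompact Φ →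
    AEMeasurable (fun ω => levelCount (S ω) K Φ) P
  expectation_count : ∀ Φ : Set ℂ, IsCompact Φ →
    ∫⁻ ω, levelCount (S ω) K Φ ∂P = ∫⁻ z in Φ, ENNReal.ofReal (h z)

/-! Write the random polynomial as its constant term η₀ plus a tail T without constant term,
independent of η₀. For a fixed tail the equation reads η₀ = K − T(z), and η₀ has the standard
Gaussian density g on ℂ. The area formula `lintegral_mul_encard_fiber_eq`, applied to z ↦ K − T(z)
with weight g, gives the mean number of solutions in Φ as the integral over Φ of |T'(z)|² g(K −
T(z)). Averaging over the tail (Tonelli) yields the Kac–Rice density h(z) = E[|T'(z)|² g(K − T(z))].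
It is continuous by dominated convergence, and integrals over compact sets determine a continuous
density.

At z = ±1 the powers of z are real, so the real parts of T and T' are linear forms in the `a j` and
the imaginary parts are linear forms in the `b j`. The expectation splits into one-dimensional
Gaussian integrals, evaluated in `integral_gaussianPDFReal_sub_mul_sq` by regressing T' on T. Power
sums of 1, …, N give the closed form. -/

/-! ### Area formula for entire functions -/

theorem abs_det_restrictScalars_toSpanSingleton (c : ℂ) :
    |((ContinuousLinearMap.toSpanSingleton ℂ c).restrictScalars ℝ).det| = ‖c‖ ^ 2 := by
  have h : ((ContinuousLinearMap.toSpanSingleton ℂ c).restrictScalars ℝ).det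
      = Algebra.norm ℝ c := by
    rw [Algebra.norm_apply]
    unfold ContinuousLinearMap.det
    congr 1
    ext; simp [mul_comm]
  rw [h, Algebra.norm_complex_apply, Complex.normSq_eq_norm_sq, abs_of_nonneg (by positivity)]

theorem HasStrictDerivAt.exists_isOpen_injOn {f : ℂ → ℂ} {f' z : ℂ} (hf : HasStrictDerivAt f f' z)
    (hf' : f' ≠ 0) : ∃ V : Set ℂ, IsOpen V ∧ z ∈ V ∧ Set.InjOn f V := by
  have h := hf.hasStrictFDerivAt_equiv hf'
  exact ⟨(h.toOpenPartialHomeomorph f).source, (h.toOpenPartialHomeomorph f).open_source,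
    h.mem_toOpenPartialHomeomorph_source, (h.toOpenPartialHomeomorph f).injOn⟩

/-- A holomorphic function is injective on the pieces of a countable measurable partition of the
complement of its critical set. -/
theorem exists_measurable_partition_injOn {f : ℂ → ℂ} (hf : Differentiable ℂ f) {s : Set ℂ}
    (hs : MeasurableSet s) :
    ∃ A : ℕ → Set ℂ, (∀ n, MeasurableSet (A n)) ∧ Pairwise (Function.onFun Disjoint A) ∧
      (∀ n, Set.InjOn f (A n)) ∧ ⋃ n, A n = s ∩ {z | deriv f z ≠ 0} := by
  have hloc : ∀ z : ℂ, ∃ V : Set ℂ, IsOpen V ∧ (deriv f z ≠ 0 → z ∈ V) ∧ Set.InjOn f V := by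
    intro z
    by_cases hz : deriv f z = 0
    · exact ⟨∅, isOpen_empty, fun h => absurd hz h, by simp⟩
    · obtain ⟨V, h1, h2, h3⟩ :=
        ((hf.contDiff (n := 1)).contDiffAt.hasStrictDerivAt one_ne_zero).exists_isOpen_injOn hz
      exact ⟨V, h1, fun _ => h2, h3⟩
  choose V hVo hVm hVi using hloc
  -- Lindelöf: countably many injectivity neighbourhoods cover the noncritical set; `disjointed`
  -- then makes them a partition.
  obtain ⟨t, hsub, ht, hcov⟩ := TopologicalSpace.countable_cover_nhdsWithin (f := V)
    (s := {z | deriv f z ≠ 0})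
    fun z hz => mem_nhdsWithin_of_mem_nhds ((hVo z).mem_nhds (hVm z hz))
  obtain ⟨W, hWo, hWi, hWc⟩ : ∃ W : ℕ → Set ℂ, (∀ n, IsOpen (W n)) ∧ (∀ n, Set.InjOn f (W n)) ∧
      {z | deriv f z ≠ 0} ⊆ ⋃ n, W n := by
    rcases t.eq_empty_or_nonempty with rfl | hne
    · exact ⟨fun _ => ∅, fun _ => isOpen_empty, by simp, by simpa using hcov⟩
    · obtain ⟨e, rfl⟩ := ht.exists_eq_range hne
      exact ⟨fun n => V (e n), fun n => hVo _, fun n => hVi _, by simpa using hcov⟩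
  have hU : MeasurableSet {z | deriv f z ≠ 0} :=
    (measurableSet_eq_fun (measurable_deriv f) measurable_const).compl
  refine ⟨fun n => (s ∩ {z | deriv f z ≠ 0}) ∩ disjointed W n, fun n => (hs.inter hU).inter
    (MeasurableSet.disjointed (fun n => (hWo n).measurableSet) n), fun i j hij =>
      ((disjoint_disjointed W) hij).mono Set.inter_subset_right Set.inter_subset_right,
    fun n => (hWi n).mono (Set.inter_subset_right.trans (disjointed_subset W n)), ?_⟩
  rw [← Set.inter_iUnion, iUnion_disjointed, Set.inter_eq_left]
  exact Set.inter_subset_right.trans hWc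

/-- **Area formula** with multiplicity for a holomorphic function. -/
theorem lintegral_mul_encard_fiber_eq {f : ℂ → ℂ} (hf : Differentiable ℂ f) {s : Set ℂ}
    (hs : MeasurableSet s) {g : ℂ → ℝ≥0∞} (hg : Measurable g) :
    ∫⁻ w, g w * ((({z ∈ s | f z = w}.encard) : ℕ∞) : ℝ≥0∞)
      = ∫⁻ z in s, ENNReal.ofReal (‖deriv f z‖ ^ 2) * g (f z) := by
  obtain ⟨A, hAm, hAd, hAi, hAU⟩ := exists_measurable_partition_injOn hf hs
  have hder : ∀ (t : Set ℂ) (z : ℂ), HasFDerivWithinAt f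
      ((ContinuousLinearMap.toSpanSingleton ℂ (deriv f z)).restrictScalars ℝ) t z := fun t z =>
    ((hf z).hasDerivAt.hasFDerivAt.restrictScalars ℝ).hasFDerivWithinAt
  have hU : MeasurableSet {z | deriv f z ≠ 0} :=
    (measurableSet_eq_fun (measurable_deriv f) measurable_const).compl
  have himg : ∀ n, MeasurableSet (f '' A n) := fun n =>
    (hAm n).image_of_continuousOn_injOn hf.continuous.continuousOn (hAi n)
  -- Easy case of Sard's theorem: critical values form a null set and can be ignored on the
  -- left-hand side.
  have hsard : volume (f '' (s \ {z | deriv f z ≠ 0})) = 0 := by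
    refine addHaar_image_eq_zero_of_det_fderivWithin_eq_zero volume (fun z _ => hder _ z) ?_
    intro z hz
    have hz0 : deriv f z = 0 := by simpa using hz.2
    rw [← abs_eq_zero, abs_det_restrictScalars_toSpanSingleton, hz0]
    simp
  -- Over a noncritical value each piece `A n` contains at most one point of the fibre, so the count
  -- is a sum of indicators of the images `f '' A n`.
  have hcount : ∀ᵐ w, g w * ((({z ∈ s | f z = w}.encard) : ℕ∞) : ℝ≥0∞)
      = ∑' n, (f '' A n).indicator g w := by
    filter_upwards [measure_eq_zero_iff_ae_notMem.1 hsard] with w hw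
    have hset : {z ∈ s | f z = w} = ⋃ n, A n ∩ f ⁻¹' {w} := by
      rw [← Set.iUnion_inter, hAU]
      ext z
      constructor
      · rintro ⟨h1, h2⟩
        refine ⟨⟨h1, ?_⟩, h2⟩
        by_contra h3
        exact hw ⟨z, ⟨h1, h3⟩, h2⟩
      · rintro ⟨⟨h1, -⟩, h2⟩
        exact ⟨h1, h2⟩
    have hm : ∀ n, MeasurableSet (A n ∩ f ⁻¹' {w}) := fun n =>
      (hAm n).inter (hf.continuous.measurable (measurableSet_singleton w))
    rw [hset, ← Measure.count_apply (MeasurableSet.iUnion hm),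
      measure_iUnion (fun i j hij => (hAd hij).mono Set.inter_subset_left Set.inter_subset_left) hm,
      ← ENNReal.tsum_mul_left]
    congr 1
    ext n
    by_cases hn : w ∈ f '' A n
    · obtain ⟨z, hz, rfl⟩ := hn
      have : A n ∩ f ⁻¹' {f z} = {z} := by
        ext y
        constructor
        · rintro ⟨h1, h2⟩
          exact hAi n h1 hz h2
        · rintro rfl
          exact ⟨hz, rfl⟩
      rw [this, Set.indicator_of_mem (Set.mem_image_of_mem f hz)]
      simp
    · have : A n ∩ f ⁻¹' {w} = ∅ := by
        ext y
        simp only [Set.mem_inter_iff, Set.mem_preimage, Set.mem_singleton_iff,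
          Set.mem_empty_iff_false, iff_false, not_and]
        exact fun h1 h2 => hn ⟨y, h1, h2⟩
      rw [this, Set.indicator_of_notMem hn]
      simp
  rw [lintegral_congr_ae hcount, lintegral_tsum fun n => (hg.indicator (himg n)).aemeasurable]
  -- Critical points contribute nothing on the right either, since the Jacobian vanishes there.
  have hsplit : ∫⁻ z in s, ENNReal.ofReal (‖deriv f z‖ ^ 2) * g (f z)
      = ∫⁻ z in s ∩ {z | deriv f z ≠ 0}, ENNReal.ofReal (‖deriv f z‖ ^ 2) * g (f z) := by
    rw [← lintegral_inter_add_sdiff _ s hU]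
    conv_rhs => rw [← add_zero (∫⁻ _ in _, _)]
    congr 1
    rw [setLIntegral_eq_zero_iff' (hs.diff hU)]
    · refine Filter.Eventually.of_forall fun z hz => ?_
      have hz0 : deriv f z = 0 := by simpa using hz.2
      simp [hz0]
    · exact ((measurable_deriv f).norm.pow_const 2).ennreal_ofReal.aemeasurable.mul
        (hg.comp hf.continuous.measurable).aemeasurable
  rw [hsplit, ← hAU, lintegral_iUnion hAm hAd]
  congr 1
  ext n
  rw [lintegral_indicator (himg n), lintegral_image_eq_lintegral_abs_det_fderiv_mul volume (hAm n)
    (fun z _ => hder _ z) (hAi n)]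
  simp_rw [abs_det_restrictScalars_toSpanSingleton]

/-! ### Measurability of the number of solutions -/

theorem natCast_le_levelCount_iff (S : ℂ → ℂ) (K : ℂ) (Φ : Set ℂ) (n : ℕ) :
    (n : ℝ≥0∞) ≤ levelCount S K Φ ↔
      ∃ t : Finset ℂ, t.card = n ∧ ∀ z ∈ t, z ∈ Φ ∧ S z = K := by
  unfold levelCount
  rw [← ENat.toENNReal_coe, ENat.toENNReal_le]
  constructor
  · intro h
    obtain ⟨t, ht, hn⟩ := Set.exists_subset_encard_eq h
    have hfin : t.Finite := Set.finite_of_encard_eq_coe hn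
    refine ⟨hfin.toFinset, ?_, fun z hz => ht (by simpa using hz)⟩
    rw [hfin.encard_eq_coe_toFinset_card] at hn
    exact_mod_cast hn
  · rintro ⟨t, rfl, ht⟩
    rw [← Set.encard_coe_eq_coe_finsetCard]
    exact Set.encard_le_encard fun z hz => ht z hz

/-- The family of closed balls with centre in a countable dense set and radius `1 / (n + 1)`. -/
noncomputable def rationalClosedBall (p : ℕ × ℕ) : Set ℂ :=
  Metric.closedBall (TopologicalSpace.denseSeq ℂ p.1) (1 / ((p.2 : ℝ) + 1))

theorem exists_rationalClosedBall {ε : ℝ} (hε : 0 < ε) (z : ℂ) :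
    ∃ p, z ∈ rationalClosedBall p ∧ rationalClosedBall p ⊆ Metric.ball z ε := by
  obtain ⟨n, hn⟩ := exists_nat_one_div_lt (half_pos hε)
  obtain ⟨m, hm⟩ := (TopologicalSpace.denseRange_denseSeq ℂ).exists_dist_lt z
    (show (0 : ℝ) < 1 / ((n : ℝ) + 1) by positivity)
  refine ⟨(m, n), hm.le, fun y hy => ?_⟩
  have hy' : dist y (TopologicalSpace.denseSeq ℂ m) ≤ 1 / ((n : ℝ) + 1) := hy
  have := dist_triangle_right y z (TopologicalSpace.denseSeq ℂ m)
  rw [Metric.mem_ball]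
  linarith

/-- Finitely many distinct points can be enclosed in disjoint balls of a countable family, and
disjoint balls contain distinct points. This replaces an uncountable choice of solutions by a
countable union of finite intersections. -/
theorem natCast_le_levelCount_iff_rationalClosedBall (S : ℂ → ℂ) (K : ℂ) (Φ : Set ℂ) (n : ℕ) :
    (n : ℝ≥0∞) ≤ levelCount S K Φ ↔
      ∃ F : Finset (ℕ × ℕ), F.card = n ∧ (F : Set (ℕ × ℕ)).PairwiseDisjoint rationalClosedBall ∧
        ∀ p ∈ F, ∃ z ∈ Φ ∩ rationalClosedBall p, S z = K := by
  classical
  rw [natCast_le_levelCount_iff]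
  constructor
  · rintro ⟨t, rfl, ht⟩
    obtain ⟨ε, hε, hsep⟩ : ∃ ε > 0, ∀ z ∈ t, ∀ y ∈ t, z ≠ y → ε ≤ dist z y := by
      have hinf : 0 < (t : Set ℂ).infsep ∨ (t : Set ℂ).Subsingleton := by
        rcases (t : Set ℂ).subsingleton_or_nontrivial with h | h
        · exact Or.inr h
        · exact Or.inl (t.finite_toSet.infsep_pos_iff_nontrivial.2 h)
      rcases hinf with h | h
      · exact ⟨_, h, fun z hz y hy hne =>
          Set.infsep_le_dist_of_mem hz hy hne⟩
      · exact ⟨1, one_pos, fun z hz y hy hne => absurd (h hz hy) hne⟩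
    choose p hp hpb using fun z => exists_rationalClosedBall (half_pos hε) z
    have hdisj : ∀ z ∈ t, ∀ y ∈ t, z ≠ y →
        Disjoint (rationalClosedBall (p z)) (rationalClosedBall (p y)) := fun z hz y hy hne =>
      (Metric.ball_disjoint_ball (by have := hsep z hz y hy hne; linarith)).mono (hpb z) (hpb y)
    refine ⟨t.image p, Finset.card_image_of_injOn fun z hz y hy hzy => ?_, ?_, ?_⟩
    · by_contra hne
      exact Set.disjoint_left.1 (hdisj z hz y hy hne) (hp z) (hzy ▸ hp z)
    · rintro _ hi _ hj hij
      obtain ⟨z, hz, rfl⟩ := Finset.mem_image.1 (Finset.mem_coe.1 hi)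
      obtain ⟨y, hy, rfl⟩ := Finset.mem_image.1 (Finset.mem_coe.1 hj)
      exact hdisj z hz y hy fun h => hij (h ▸ rfl)
    · intro q hq
      obtain ⟨z, hz, rfl⟩ := Finset.mem_image.1 hq
      exact ⟨z, ⟨(ht z hz).1, hp z⟩, (ht z hz).2⟩
  · rintro ⟨F, rfl, hd, hF⟩
    choose! z hz hzK using hF
    refine ⟨F.image z, Finset.card_image_of_injOn fun p hp q hq hpq => ?_, fun y hy => ?_⟩
    · by_contra hne
      exact Set.disjoint_left.1 (hd hp hq hne) (hz p hp).2 (hpq ▸ (hz q hq).2)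
    · obtain ⟨p, hp, rfl⟩ := Finset.mem_image.1 hy
      exact ⟨(hz p hp).1, hzK p hp⟩

/-- The number of solutions in a compact set is a measurable function of a parameter on which the
equation depends continuously. -/
theorem measurable_levelCount {X : Type*} [TopologicalSpace X] [MeasurableSpace X]
    [OpensMeasurableSpace X] {F : X → ℂ → ℂ} (hF : Continuous (Function.uncurry F)) (K : ℂ)
    {Φ : Set ℂ} (hΦ : IsCompact Φ) : Measurable fun x => levelCount (F x) K Φ := by
  -- Projection along a compact factor is a closed map.
  have hclosed : ∀ C : Set ℂ, IsCompact C → IsClosed {x | ∃ z ∈ C, F x z = K} := by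
    intro C hC
    have := isCompact_iff_compactSpace.1 hC
    have h1 : IsClosed {q : X × C | F q.1 q.2 = K} :=
      isClosed_eq (hF.comp (by fun_prop : Continuous fun q : X × C => (q.1, (q.2 : ℂ))))
        continuous_const
    convert isClosedMap_fst_of_compactSpace _ h1 using 1
    ext x
    simp
  have hset : ∀ n : ℕ, MeasurableSet {x | (n : ℝ≥0∞) ≤ levelCount (F x) K Φ} := by
    intro n
    simp_rw [natCast_le_levelCount_iff_rationalClosedBall]
    have : {x | ∃ G : Finset (ℕ × ℕ), G.card = n ∧
        (G : Set (ℕ × ℕ)).PairwiseDisjoint rationalClosedBall ∧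
        ∀ p ∈ G, ∃ z ∈ Φ ∩ rationalClosedBall p, F x z = K}
        = ⋃ G : {G : Finset (ℕ × ℕ) // G.card = n ∧
          (G : Set (ℕ × ℕ)).PairwiseDisjoint rationalClosedBall},
          ⋂ p ∈ G.1, {x | ∃ z ∈ Φ ∩ rationalClosedBall p, F x z = K} := by
      ext x
      simp [and_assoc]
    rw [this]
    exact MeasurableSet.iUnion fun G => Finset.measurableSet_biInter _ fun p _ =>
      (hclosed _ (hΦ.inter_right Metric.isClosed_closedBall)).measurableSet
  have hm : Measurable fun x => {z ∈ Φ | F x z = K}.encard := by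
    refine ENat.measurable_iff.2 fun n => ?_
    convert (hset n).diff (hset (n + 1)) using 1
    ext x
    simp only [Set.mem_preimage, Set.mem_singleton_iff, Set.mem_sdiff, Set.mem_ofPred_eq, levelCount,
      ← ENat.toENNReal_coe, ENat.toENNReal_le, not_le]
    rw [Nat.cast_add, Nat.cast_one, ENat.lt_natCast_add_one_iff, le_antisymm_iff, and_comm]
  exact (Measurable.of_discrete (f := ((↑) : ℕ∞ → ℝ≥0∞))).comp hm

/-! ### One-dimensional Gaussian integrals -/

/-- Completing the square in a product of two Gaussian densities. -/
theorem gaussianPDFReal_mul_gaussianPDFReal {A : NNReal} (hA : A ≠ 0) (k x : ℝ) :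
    gaussianPDFReal 0 1 (k - x) * gaussianPDFReal 0 A x
      = gaussianPDFReal 0 (1 + A) k * gaussianPDFReal (k * A / (1 + A)) (A / (1 + A)) x := by
  have hA' : (0 : ℝ) < A := by exact_mod_cast pos_iff_ne_zero.2 hA
  simp only [gaussianPDFReal, NNReal.coe_one, NNReal.coe_add, NNReal.coe_div, sub_zero]
  rw [mul_mul_mul_comm, mul_mul_mul_comm (√(2 * Real.pi * (1 + (A : ℝ))))⁻¹, ← Real.exp_add,
    ← Real.exp_add, ← mul_inv, ← mul_inv,
    ← Real.sqrt_mul (by positivity), ← Real.sqrt_mul (by positivity)]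
  congr 1
  · congr 2
    field_simp
  · congr 1
    field_simp
    ring

theorem gaussianPDFReal_le_one (x : ℝ) : gaussianPDFReal 0 1 x ≤ 1 := by
  simp only [gaussianPDFReal, NNReal.coe_one, mul_one, sub_zero]
  have h1 : (√(2 * Real.pi))⁻¹ ≤ 1 := by
    apply inv_le_one_of_one_le₀
    rw [Real.one_le_sqrt]
    linarith [Real.pi_gt_three]
  have h2 : Real.exp (-x ^ 2 / 2) ≤ 1 := by
    rw [Real.exp_le_one_iff]
    have := sq_nonneg x
    linarith
  exact mul_le_one₀ h1 (Real.exp_pos _).le h2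

theorem continuous_gaussianPDFReal (m : ℝ) (v : NNReal) : Continuous (gaussianPDFReal m v) := by
  unfold gaussianPDFReal
  fun_prop

section
variable {Ω : Type*} [MeasurableSpace Ω] {P : Measure Ω}

/-- Bayes' rule for Gaussians: the right-hand integral is over the law of `X` given that `X` plus
independent standard noise equals `k`, and the prefactor is the density of that sum at `k`. -/
theorem integral_gaussianPDFReal_sub_mul {X : Ω → ℝ} {A : NNReal} (hA : A ≠ 0)
    (hX : HasLaw X (gaussianReal 0 A) P) (k : ℝ) {f : ℝ → ℝ} (hf : Continuous f) :
    ∫ ω, gaussianPDFReal 0 1 (k - X ω) * f (X ω) ∂P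
      = gaussianPDFReal 0 (1 + A) k * ∫ x, f x ∂gaussianReal (k * A / (1 + A)) (A / (1 + A)) := by
  have h := hX.integral_comp (f := fun x => gaussianPDFReal 0 1 (k - x) * f x)
    (((continuous_gaussianPDFReal 0 1).comp (by fun_prop)).mul hf).aestronglyMeasurable
  simp only [Function.comp_def] at h
  have hA2 : A / (1 + A) ≠ 0 := div_ne_zero hA (by positivity)
  rw [h, integral_gaussianReal_eq_integral_smul hA, integral_gaussianReal_eq_integral_smul hA2,
    ← integral_const_mul]
  congr 1
  ext x
  simp only [smul_eq_mul]
  rw [← mul_assoc, ← mul_assoc, ← gaussianPDFReal_mul_gaussianPDFReal hA,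
    mul_comm (gaussianPDFReal 0 A x)]

theorem integral_sq_gaussianReal (m : ℝ) (v : NNReal) :
    ∫ x, x ^ 2 ∂gaussianReal m v = v + m ^ 2 := by
  have h := variance_eq_sub (memLp_id_gaussianReal (μ := m) (v := v) 2)
  rw [variance_id_gaussianReal] at h
  simp only [Pi.pow_apply, id_eq, integral_id_gaussianReal] at h
  linarith

theorem integral_gaussianPDFReal_sub {X : Ω → ℝ} {A : NNReal} (hA : A ≠ 0)
    (hX : HasLaw X (gaussianReal 0 A) P) (k : ℝ) :
    ∫ ω, gaussianPDFReal 0 1 (k - X ω) ∂P = gaussianPDFReal 0 (1 + A) k := by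
  simpa using integral_gaussianPDFReal_sub_mul hA hX k (f := fun _ => 1) continuous_const

theorem integrable_bounded_gaussian_mul {X Z : Ω → ℝ} (hX : AEMeasurable X P) (k : ℝ)
    (hZ : Integrable Z P) : Integrable (fun ω => gaussianPDFReal 0 1 (k - X ω) * Z ω) P := by
  refine hZ.bdd_mul (c := 1) ?_ (Filter.Eventually.of_forall fun ω => ?_)
  · exact ((measurable_gaussianPDFReal 0 1).comp_aemeasurable
      (by fun_prop)).aestronglyMeasurable
  · rw [Real.norm_of_nonneg (gaussianPDFReal_nonneg _ _ _)]
    exact gaussianPDFReal_le_one _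

variable {ι : Type*} [Fintype ι] {a : ι → Ω → ℝ}

theorem hasGaussianLaw_sum_prod (ha : ∀ j, HasLaw (a j) (gaussianReal 0 1) P)
    (hi : iIndepFun a P) (α β : ι → ℝ) :
    HasGaussianLaw (fun ω => (∑ j, α j * a j ω, ∑ j, β j * a j ω)) P := by
  have h := hi.hasGaussianLaw fun j => (ha j).hasGaussianLaw
  have := h.map_fun ((∑ j, α j • ContinuousLinearMap.proj (R := ℝ) (φ := fun _ : ι => ℝ) j).prod
    (∑ j, β j • ContinuousLinearMap.proj (R := ℝ) (φ := fun _ : ι => ℝ) j))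
  simpa using this

theorem covariance_sum_sum_gaussian (ha : ∀ j, HasLaw (a j) (gaussianReal 0 1) P)
    (hi : iIndepFun a P) (α β : ι → ℝ) :
    cov[fun ω => ∑ j, α j * a j ω, fun ω => ∑ j, β j * a j ω; P] = ∑ j, α j * β j := by
  classical
  have hL : ∀ j, MemLp (a j) 2 P := fun j => (ha j).hasGaussianLaw.memLp_two
  have := hi.isProbabilityMeasure
  rw [covariance_fun_sum_fun_sum (fun j => (hL j).const_mul _) (fun j => (hL j).const_mul _)]
  refine Finset.sum_congr rfl fun i _ => ?_
  rw [Finset.sum_eq_single i]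
  · rw [covariance_const_mul_left, covariance_const_mul_right,
      covariance_self (ha i).aemeasurable, (ha i).variance_eq, variance_id_gaussianReal]
    simp
  · intro j _ hj
    rw [covariance_const_mul_left, covariance_const_mul_right,
      (hi.indepFun hj.symm).covariance_eq_zero (hL i) (hL j)]
    simp
  · simp

theorem integral_sum_gaussian (ha : ∀ j, HasLaw (a j) (gaussianReal 0 1) P) (α : ι → ℝ) :
    ∫ ω, ∑ j, α j * a j ω ∂P = 0 := by
  rw [integral_finsetSum _ fun j _ => ((ha j).hasGaussianLaw.integrable).const_mul _]
  refine Finset.sum_eq_zero fun j _ => ?_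
  rw [integral_const_mul, (ha j).integral_eq]
  simp [integral_id_gaussianReal]

theorem hasLaw_sum_gaussian (ha : ∀ j, HasLaw (a j) (gaussianReal 0 1) P)
    (hi : iIndepFun a P) (α : ι → ℝ) {A : NNReal} (hA : (A : ℝ) = ∑ j, α j ^ 2) :
    HasLaw (fun ω => ∑ j, α j * a j ω) (gaussianReal 0 A) P := by
  have h := (hasGaussianLaw_sum_prod ha hi α α).fst
  refine ⟨h.aemeasurable, ?_⟩
  rw [h.map_eq_gaussianReal, integral_sum_gaussian ha, ← covariance_self h.aemeasurable,
    covariance_sum_sum_gaussian ha hi]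
  congr 1
  rw [← Real.toNNReal_coe (r := A), hA]
  simp [sq]

/-- Second moment of one linear combination of independent standard normal variables, weighted by
the normal density at another one. -/
theorem integral_gaussianPDFReal_sub_mul_sq (ha : ∀ j, HasLaw (a j) (gaussianReal 0 1) P)
    (hi : iIndepFun a P) (α β : ι → ℝ) {A : NNReal} (hA0 : A ≠ 0) (hA : (A : ℝ) = ∑ j, α j ^ 2)
    (k : ℝ) :
    ∫ ω, gaussianPDFReal 0 1 (k - ∑ j, α j * a j ω) * (∑ j, β j * a j ω) ^ 2 ∂P
      = gaussianPDFReal 0 (1 + A) k * (∑ j, β j ^ 2 - (∑ j, α j * β j) ^ 2 / (1 + A)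
        + (∑ j, α j * β j) ^ 2 * k ^ 2 / (1 + A) ^ 2) := by
  have hA' : (0 : ℝ) < A := by exact_mod_cast pos_iff_ne_zero.2 hA0
  set B := ∑ j, α j * β j with hB
  -- The regression coefficient: it makes the residual `R` below uncorrelated with `X`, hence
  -- independent of it, the pair being jointly Gaussian.
  set c : ℝ := B / A with hc
  set X : Ω → ℝ := fun ω => ∑ j, α j * a j ω with hXdef
  set R : Ω → ℝ := fun ω => ∑ j, (β j - c * α j) * a j ω with hRdef
  have hX : HasLaw X (gaussianReal 0 A) P := hasLaw_sum_gaussian ha hi α hA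
  have hXR := hasGaussianLaw_sum_prod ha hi α (fun j => β j - c * α j)
  have hindep : IndepFun X R P := by
    refine hXR.indepFun_of_covariance_eq_zero ?_
    rw [covariance_sum_sum_gaussian ha hi]
    have : ∀ j, α j * (β j - c * α j) = α j * β j - c * α j ^ 2 := fun j => by ring
    simp_rw [this]
    rw [Finset.sum_sub_distrib, ← Finset.mul_sum, ← hA, ← hB, hc]
    field_simp
    ring
  have hR0 : ∫ ω, R ω ∂P = 0 := integral_sum_gaussian ha _
  have hR2L : MemLp R 2 P := hXR.snd.memLp_two
  have hX2L : MemLp X 2 P := hXR.fst.memLp_two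
  have := hi.isProbabilityMeasure
  have hR2 : ∫ ω, R ω ^ 2 ∂P = ∑ j, β j ^ 2 - B ^ 2 / A := by
    have h1 := variance_eq_sub hR2L
    rw [← covariance_self hXR.snd.aemeasurable, covariance_sum_sum_gaussian ha hi, hR0] at h1
    simp only [Pi.pow_apply] at h1
    have : ∀ j, (β j - c * α j) * (β j - c * α j)
        = β j ^ 2 - 2 * c * (α j * β j) + c ^ 2 * α j ^ 2 := fun j => by ring
    simp_rw [this] at h1
    rw [Finset.sum_add_distrib, Finset.sum_sub_distrib, ← Finset.mul_sum, ← Finset.mul_sum, ← hA,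
      ← hB, hc] at h1
    rw [show ∫ ω, R ω ^ 2 ∂P = _ from by simpa using h1.symm]
    field_simp
    ring
  have hexp : ∀ ω, gaussianPDFReal 0 1 (k - X ω) * (∑ j, β j * a j ω) ^ 2
      = c ^ 2 * (gaussianPDFReal 0 1 (k - X ω) * X ω ^ 2)
        + 2 * c * (gaussianPDFReal 0 1 (k - X ω) * X ω * R ω)
        + gaussianPDFReal 0 1 (k - X ω) * R ω ^ 2 := by
    intro ω
    have : ∑ j, β j * a j ω = c * X ω + R ω := by
      rw [hXdef, hRdef]
      simp only
      rw [Finset.mul_sum, ← Finset.sum_add_distrib]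
      exact Finset.sum_congr rfl fun j _ => by ring
    rw [this]
    ring
  have hmg : Measurable fun x : ℝ => gaussianPDFReal 0 1 (k - x) :=
    (measurable_gaussianPDFReal 0 1).comp (by fun_prop)
  have hXm : AEMeasurable X P := hXR.fst.aemeasurable
  have hRm : AEMeasurable R P := hXR.snd.aemeasurable
  have hgXm : AEStronglyMeasurable (fun ω => gaussianPDFReal 0 1 (k - X ω)) P :=
    (hmg.comp_aemeasurable hXm).aestronglyMeasurable
  have hcross : ∫ ω, gaussianPDFReal 0 1 (k - X ω) * X ω * R ω ∂P = 0 := by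
    have hcomp : IndepFun (fun ω => gaussianPDFReal 0 1 (k - X ω) * X ω) R P :=
      hindep.comp (φ := fun x => gaussianPDFReal 0 1 (k - x) * x) (ψ := id)
        (hmg.mul measurable_id) measurable_id
    rw [hcomp.integral_fun_mul_eq_mul_integral (hgXm.mul hXm.aestronglyMeasurable)
      hRm.aestronglyMeasurable, hR0, mul_zero]
  have hlast : ∫ ω, gaussianPDFReal 0 1 (k - X ω) * R ω ^ 2 ∂P
      = gaussianPDFReal 0 (1 + A) k * (∑ j, β j ^ 2 - B ^ 2 / A) := by
    have hcomp : IndepFun (fun ω => gaussianPDFReal 0 1 (k - X ω)) (fun ω => R ω ^ 2) P :=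
      hindep.comp (φ := fun x => gaussianPDFReal 0 1 (k - x)) (ψ := fun x => x ^ 2)
        hmg (by fun_prop)
    rw [hcomp.integral_fun_mul_eq_mul_integral hgXm (by fun_prop), hR2,
      integral_gaussianPDFReal_sub hA0 hX]
  have hI1 := integrable_bounded_gaussian_mul hXm k hX2L.integrable_sq
  have hI2 : Integrable (fun ω => gaussianPDFReal 0 1 (k - X ω) * X ω * R ω) P := by
    simp_rw [mul_assoc]
    exact integrable_bounded_gaussian_mul hXm k (hX2L.integrable_mul hR2L)
  have hI3 := integrable_bounded_gaussian_mul hXm k hR2L.integrable_sq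
  have hI12 : Integrable (fun ω => c ^ 2 * (gaussianPDFReal 0 1 (k - X ω) * X ω ^ 2)
      + 2 * c * (gaussianPDFReal 0 1 (k - X ω) * X ω * R ω)) P :=
    (hI1.const_mul _).add (hI2.const_mul _)
  refine (integral_congr_ae (.of_forall hexp)).trans ?_
  rw [integral_add hI12 hI3,
    integral_add (hI1.const_mul _) (hI2.const_mul _), integral_const_mul, integral_const_mul,
    hcross, hlast, integral_gaussianPDFReal_sub_mul hA0 hX k (f := fun x => x ^ 2) (by fun_prop),
    integral_sq_gaussianReal, hc]
  push_cast
  field_simp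
  ring

end

/-! ### Complex Gaussian law and independence of blocks -/

/-- The density of the standard Gaussian law on `ℂ`, whose real and imaginary parts are independent
standard normal variables. -/
noncomputable def stdComplexGaussianPDF (w : ℂ) : ℝ :=
  gaussianPDFReal 0 1 w.re * gaussianPDFReal 0 1 w.im

theorem continuous_stdComplexGaussianPDF : Continuous stdComplexGaussianPDF :=
  ((continuous_gaussianPDFReal 0 1).comp Complex.continuous_re).mul
    ((continuous_gaussianPDFReal 0 1).comp Complex.continuous_im)

theorem stdComplexGaussianPDF_nonneg (w : ℂ) : 0 ≤ stdComplexGaussianPDF w :=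
  mul_nonneg (gaussianPDFReal_nonneg _ _ _) (gaussianPDFReal_nonneg _ _ _)

theorem stdComplexGaussianPDF_le_one (w : ℂ) : stdComplexGaussianPDF w ≤ 1 :=
  mul_le_one₀ (gaussianPDFReal_le_one _) (gaussianPDFReal_nonneg _ _ _) (gaussianPDFReal_le_one _)

theorem hasLaw_add_I_mul {Ω : Type*} [MeasurableSpace Ω] {P : Measure Ω} [IsProbabilityMeasure P]
    {X Y : Ω → ℝ} (hX : HasLaw X (gaussianReal 0 1) P) (hY : HasLaw Y (gaussianReal 0 1) P)
    (hXY : IndepFun X Y P) :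
    HasLaw (fun ω => (X ω : ℂ) + Complex.I * (Y ω : ℂ))
      (volume.withDensity fun w => ENNReal.ofReal (stdComplexGaussianPDF w)) P := by
  have h := hXY.hasLaw_prod hX hY
  rw [gaussianReal_of_var_ne_zero 0 one_ne_zero, prod_withDensity
    (measurable_gaussianPDF 0 1) (measurable_gaussianPDF 0 1), ← Measure.volume_eq_prod] at h
  have hmp : MeasurePreserving Complex.measurableEquivRealProd.symm
      (volume.withDensity fun p : ℝ × ℝ => gaussianPDF 0 1 p.1 * gaussianPDF 0 1 p.2)
      (volume.withDensity fun w => ENNReal.ofReal (stdComplexGaussianPDF w)) := by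
    refine ⟨Complex.measurableEquivRealProd.symm.measurable, ?_⟩
    ext s hs
    rw [Measure.map_apply Complex.measurableEquivRealProd.symm.measurable hs,
      withDensity_apply _ (Complex.measurableEquivRealProd.symm.measurable hs),
      withDensity_apply _ hs,
      ← Complex.volume_preserving_equiv_real_prod.symm.setLIntegral_comp_preimage hs
        continuous_stdComplexGaussianPDF.measurable.ennreal_ofReal]
    refine lintegral_congr fun p => ?_
    simp [stdComplexGaussianPDF, gaussianPDF, ENNReal.ofReal_mul (gaussianPDFReal_nonneg _ _ _)]
  have h2 := hmp.fun_comp_hasLaw h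
  convert h2 using 2 with ω
  apply Complex.ext <;> simp

/-- Serves twice: to separate the constant term from the tail, and the real parts of the tail
coefficients from the imaginary parts. -/
theorem ProbabilityTheory.iIndepFun.indepFun_reindex {Ω ι κ κ' E : Type*} [MeasurableSpace Ω]
    {P : Measure Ω} [Fintype κ] [Fintype κ'] [MeasurableSpace E] {X : ι → Ω → E}
    (hX : iIndepFun X P) (hm : ∀ i, AEMeasurable (X i) P) (σ : κ → ι) (τ : κ' → ι)
    (hστ : ∀ k l, σ k ≠ τ l) :
    IndepFun (fun ω k => X (σ k) ω) (fun ω l => X (τ l) ω) P := by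
  classical
  have hd : Disjoint (Finset.univ.image σ) (Finset.univ.image τ) := by
    rw [Finset.disjoint_left]
    intro i hi hj
    obtain ⟨k, -, rfl⟩ := Finset.mem_image.1 hi
    obtain ⟨l, -, h⟩ := Finset.mem_image.1 hj
    exact hστ k l h.symm
  exact (hX.indepFun_finset₀ _ _ hd hm).comp
    (φ := fun x k => x ⟨σ k, Finset.mem_image_of_mem σ (Finset.mem_univ k)⟩)
    (ψ := fun x l => x ⟨τ l, Finset.mem_image_of_mem τ (Finset.mem_univ l)⟩)
    (by fun_prop) (by fun_prop)

/-! ### Kac–Rice formula and uniqueness of the density -/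

/-- The polynomial without constant term with coefficients `v`. -/
noncomputable def tailPoly {N : ℕ} (v : Fin N → ℂ) (z : ℂ) : ℂ := ∑ j, v j * z ^ ((j : ℕ) + 1)

/-- The derivative of `tailPoly v`. -/
noncomputable def tailPolyDeriv {N : ℕ} (v : Fin N → ℂ) (z : ℂ) : ℂ :=
  ∑ j, v j * ((((j : ℕ) : ℂ) + 1) * z ^ (j : ℕ))

theorem continuous_uncurry_tailPoly (N : ℕ) :
    Continuous fun p : (Fin N → ℂ) × ℂ => tailPoly p.1 p.2 := by
  unfold tailPoly
  fun_prop

theorem continuous_uncurry_tailPolyDeriv (N : ℕ) :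
    Continuous fun p : (Fin N → ℂ) × ℂ => tailPolyDeriv p.1 p.2 := by
  unfold tailPolyDeriv
  fun_prop

theorem hasDerivAt_tailPoly {N : ℕ} (v : Fin N → ℂ) (z : ℂ) :
    HasDerivAt (tailPoly v) (tailPolyDeriv v z) z := by
  unfold tailPoly tailPolyDeriv
  refine HasDerivAt.fun_sum fun j _ => ?_
  have := (hasDerivAt_pow ((j : ℕ) + 1) z).const_mul (v j)
  simpa using this

theorem norm_tailPolyDeriv_le {N : ℕ} (v : Fin N → ℂ) {z : ℂ} {r : ℝ} (hz : ‖z‖ ≤ r) :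
    ‖tailPolyDeriv v z‖ ≤ ∑ j, ‖v j‖ * ((((j : ℕ) : ℝ) + 1) * r ^ (j : ℕ)) := by
  refine (norm_sum_le _ _).trans (Finset.sum_le_sum fun j _ => ?_)
  rw [norm_mul, norm_mul, norm_pow]
  have : ‖((j : ℕ) : ℂ) + 1‖ = ((j : ℕ) : ℝ) + 1 := by
    rw [← Nat.cast_succ, Complex.norm_natCast, Nat.cast_succ]
  rw [this]
  gcongr

/-- The Kac–Rice integrand: the density at `K` of a standard complex Gaussian variable added to
`tailPoly v z`, times the Jacobian determinant of `tailPoly v` at `z`. -/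
noncomputable def kacRiceIntegrand {N : ℕ} (K : ℂ) (v : Fin N → ℂ) (z : ℂ) : ℝ :=
  ‖tailPolyDeriv v z‖ ^ 2 * stdComplexGaussianPDF (K - tailPoly v z)

theorem kacRiceIntegrand_nonneg {N : ℕ} (K : ℂ) (v : Fin N → ℂ) (z : ℂ) :
    0 ≤ kacRiceIntegrand K v z :=
  mul_nonneg (by positivity) (stdComplexGaussianPDF_nonneg _)

theorem continuous_uncurry_kacRiceIntegrand {N : ℕ} (K : ℂ) :
    Continuous fun p : (Fin N → ℂ) × ℂ => kacRiceIntegrand K p.1 p.2 :=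
  ((continuous_uncurry_tailPolyDeriv N).norm.pow 2).mul
    (continuous_stdComplexGaussianPDF.comp
      (continuous_const.sub (continuous_uncurry_tailPoly N)))

theorem kacRiceIntegrand_le {N : ℕ} (K : ℂ) (v : Fin N → ℂ) {z : ℂ} {r : ℝ} (hz : ‖z‖ ≤ r) :
    kacRiceIntegrand K v z ≤ (∑ j, ‖v j‖ * ((((j : ℕ) : ℝ) + 1) * r ^ (j : ℕ))) ^ 2 := by
  unfold kacRiceIntegrand
  calc _ ≤ ‖tailPolyDeriv v z‖ ^ 2 * 1 := by
        gcongr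
        exact stdComplexGaussianPDF_le_one _
    _ ≤ _ := by
        rw [mul_one]
        gcongr
        exact norm_tailPolyDeriv_le v hz

/-- Solving for the constant term turns the count into the fibre of `K - tailPoly v` over `u`, so
this is the area formula weighted by the Gaussian density. -/
theorem lintegral_levelCount_add_tailPoly {N : ℕ} (K : ℂ) (v : Fin N → ℂ) {Φ : Set ℂ}
    (hΦ : IsCompact Φ) :
    ∫⁻ u, levelCount (fun z => u + tailPoly v z) K Φ
        ∂(volume.withDensity fun w => ENNReal.ofReal (stdComplexGaussianPDF w))
      = ∫⁻ z in Φ, ENNReal.ofReal (kacRiceIntegrand K v z) := by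
  have hder : ∀ z, HasDerivAt (fun z => K - tailPoly v z) (-tailPolyDeriv v z) z := fun z =>
    (hasDerivAt_tailPoly v z).const_sub K
  have hm := continuous_stdComplexGaussianPDF.measurable.ennreal_ofReal
  have hT : Continuous (tailPoly v) :=
    (continuous_uncurry_tailPoly N).comp (continuous_const.prodMk continuous_id)
  rw [lintegral_withDensity_eq_lintegral_mul _ hm (measurable_levelCount
    (F := fun u z => u + tailPoly v z) (by
      unfold Function.uncurry
      exact continuous_fst.add (hT.comp continuous_snd)) K hΦ)]
  have := lintegral_mul_encard_fiber_eq (f := fun z => K - tailPoly v z)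
    (fun z => (hder z).differentiableAt) hΦ.measurableSet hm
  calc _ = _ := lintegral_congr fun u => by
        rw [Pi.mul_apply, levelCount]
        congr 5
        ext z
        exact and_congr_right fun _ => ⟨fun h => by rw [← h]; ring, fun h => by rw [← h]; ring⟩
    _ = _ := this
    _ = _ := lintegral_congr fun z => by
        rw [(hder z).deriv, norm_neg, kacRiceIntegrand, ENNReal.ofReal_mul (by positivity)]

section
variable {Ω : Type*} [MeasurableSpace Ω] {P : Measure Ω} {N : ℕ}

theorem integrable_sq_sum_norm {V : Ω → Fin N → ℂ} (hV : ∀ j, MemLp (fun ω => V ω j) 2 P)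
    (c : Fin N → ℝ) : Integrable (fun ω => (∑ j, ‖V ω j‖ * c j) ^ 2) P := by
  have : MemLp (fun ω => ∑ j, ‖V ω j‖ * c j) 2 P :=
    memLp_finsetSum _ fun j _ => (hV j).norm.mul_const (c j)
  exact this.integrable_sq

theorem integrable_kacRiceIntegrand {V : Ω → Fin N → ℂ} (hV : ∀ j, MemLp (fun ω => V ω j) 2 P)
    (K z : ℂ) : Integrable (fun ω => kacRiceIntegrand K (V ω) z) P := by
  refine (integrable_sq_sum_norm hV fun j => ((((j : ℕ) : ℝ) + 1) * ‖z‖ ^ (j : ℕ))).mono' ?_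
    (.of_forall fun ω => ?_)
  · have hVm : AEMeasurable V P := aemeasurable_pi_iff.2 fun j => (hV j).aemeasurable
    have hVz : AEMeasurable (fun ω => (V ω, z)) P := hVm.prodMk aemeasurable_const
    have hm : Measurable fun p : (Fin N → ℂ) × ℂ => kacRiceIntegrand K p.1 p.2 :=
      (continuous_uncurry_kacRiceIntegrand K).measurable
    exact (hm.comp_aemeasurable hVz).aestronglyMeasurable
  · rw [Real.norm_of_nonneg (kacRiceIntegrand_nonneg _ _ _)]
    exact kacRiceIntegrand_le K (V ω) (le_refl ‖z‖)

theorem continuous_integral_kacRiceIntegrand {V : Ω → Fin N → ℂ}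
    (hV : ∀ j, MemLp (fun ω => V ω j) 2 P) (K : ℂ) :
    Continuous fun z => ∫ ω, kacRiceIntegrand K (V ω) z ∂P := by
  refine continuous_iff_continuousAt.2 fun z₀ => ?_
  refine continuousAt_of_dominated
    -- Dominates the integrand on the whole unit ball around `z₀`; integrable because the
    -- coefficients are square integrable.
    (bound := fun ω => (∑ j, ‖V ω j‖ * ((((j : ℕ) : ℝ) + 1) * (‖z₀‖ + 1) ^ (j : ℕ))) ^ 2)
    (.of_forall fun z => (integrable_kacRiceIntegrand hV K z).aestronglyMeasurable) ?_
    (integrable_sq_sum_norm hV _) (.of_forall fun ω => ?_)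
  · filter_upwards [Metric.ball_mem_nhds z₀ one_pos] with z hz
    refine .of_forall fun ω => ?_
    rw [Real.norm_of_nonneg (kacRiceIntegrand_nonneg _ _ _)]
    refine kacRiceIntegrand_le K (V ω) ?_
    have h1 : ‖z - z₀‖ < 1 := by simpa [dist_eq_norm] using hz
    have h2 := norm_le_norm_add_norm_sub' z z₀
    linarith
  · exact ((continuous_uncurry_kacRiceIntegrand K).comp
      (continuous_const.prodMk continuous_id)).continuousAt

/-- Two continuous expected densities of the same random equation agree. -/
theorem IsExpectedZeroDensity.unique {S : Ω → ℂ → ℂ} {K : ℂ} {h₁ h₂ : ℂ → ℝ}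
    (H₁ : IsExpectedZeroDensity P S K h₁) (H₂ : IsExpectedZeroDensity P S K h₂) : h₁ = h₂ := by
  have hint : ∀ {h : ℂ → ℝ}, IsExpectedZeroDensity P S K h → ∀ Φ : Set ℂ, IsCompact Φ →
      ∫ z in Φ, h z = (∫⁻ ω, levelCount (S ω) K Φ ∂P).toReal := by
    intro h H Φ hΦ
    rw [H.expectation_count Φ hΦ, integral_eq_lintegral_of_nonneg_ae (.of_forall H.nonneg)
      H.continuous.aestronglyMeasurable]
  -- Vanishing integrals over compact sets give equality almost everywhere; continuity upgrades this
  -- to equality everywhere.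
  have hae : (fun z => h₁ z - h₂ z) =ᵐ[volume] 0 := by
    refine ae_eq_zero_of_forall_setIntegral_isCompact_eq_zero'
      (H₁.continuous.sub H₂.continuous).locallyIntegrable fun Φ hΦ => ?_
    rw [integral_sub (H₁.continuous.locallyIntegrable.integrableOn_isCompact hΦ)
      (H₂.continuous.locallyIntegrable.integrableOn_isCompact hΦ), hint H₁ Φ hΦ, hint H₂ Φ hΦ,
      sub_self]
  have := (Continuous.ae_eq_iff_eq volume (H₁.continuous.sub H₂.continuous)
    continuous_zero).1 hae
  ext z
  exact sub_eq_zero.1 (congrFun this z)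

variable {a b : Fin (N + 1) → Ω → ℝ}

/-- The coefficients of positive degree of the random polynomial. -/
def tailCoeffs {Ω : Type*} {N : ℕ} (a b : Fin (N + 1) → Ω → ℝ) (ω : Ω) (j : Fin N) : ℂ :=
  (a j.succ ω : ℂ) + Complex.I * (b j.succ ω : ℂ)

theorem randomSum_pow_eq {Ω : Type*} {N : ℕ} (a b : Fin (N + 1) → Ω → ℝ) (ω : Ω) (z : ℂ) :
    randomSum (fun j z => z ^ (j : ℕ)) a b ω z
      = ((a 0 ω : ℂ) + Complex.I * (b 0 ω : ℂ)) + tailPoly (tailCoeffs a b ω) z := by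
  simp [randomSum, Fin.sum_univ_succ, tailPoly, tailCoeffs]

namespace IsStdGaussianCoeffs

theorem aemeasurable_elim (hab : IsStdGaussianCoeffs P a b) (i) :
    AEMeasurable (Sum.elim a b i) P := by
  rcases i with i | i
  · exact (hab.law_a i).aemeasurable
  · exact (hab.law_b i).aemeasurable

theorem memLp_tailCoeffs (hab : IsStdGaussianCoeffs P a b) (j : Fin N) :
    MemLp (fun ω => tailCoeffs a b ω j) 2 P := by
  have h1 : MemLp (fun ω => (a j.succ ω : ℂ)) 2 P :=
    (hab.law_a j.succ).hasGaussianLaw.memLp_two.ofReal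
  have h2 : MemLp (fun ω => (b j.succ ω : ℂ)) 2 P :=
    (hab.law_b j.succ).hasGaussianLaw.memLp_two.ofReal
  exact h1.add (h2.const_mul Complex.I)

theorem hasLaw_prod (hab : IsStdGaussianCoeffs P a b) :
    HasLaw (fun ω => ((a 0 ω : ℂ) + Complex.I * (b 0 ω : ℂ), tailCoeffs a b ω))
      ((volume.withDensity fun w => ENNReal.ofReal (stdComplexGaussianPDF w)).prod
        (P.map (tailCoeffs a b))) P := by
  have hVm : AEMeasurable (tailCoeffs a b) P :=
    aemeasurable_pi_iff.2 fun j => (hab.memLp_tailCoeffs j).aemeasurable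
  have := hab.indep.isProbabilityMeasure
  have h0 := hasLaw_add_I_mul (hab.law_a 0) (hab.law_b 0)
    (hab.indep.indepFun (i := Sum.inl 0) (j := Sum.inr 0) (by simp))
  have := Measure.isProbabilityMeasure_map (μ := P) hVm
  have := h0.isProbabilityMeasure_iff.1 inferInstance
  have hind := hab.indep.indepFun_reindex hab.aemeasurable_elim
    (Sum.map (fun _ : Unit => 0) (fun _ : Unit => 0))
    (Sum.map (Fin.succ (n := N)) (Fin.succ (n := N)))
    (by rintro (k | k) (l | l) <;> simp [(Fin.succ_ne_zero _).symm])
  have hind' : IndepFun (fun ω => (a 0 ω : ℂ) + Complex.I * (b 0 ω : ℂ)) (tailCoeffs a b) P :=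
    hind.comp (φ := fun x : Unit ⊕ Unit → ℝ => (x (Sum.inl ()) : ℂ) + Complex.I * (x (Sum.inr ()) : ℂ))
      (ψ := fun (x : Fin N ⊕ Fin N → ℝ) j => (x (Sum.inl j) : ℂ) + Complex.I * (x (Sum.inr j) : ℂ))
      (by fun_prop) (by fun_prop)
  exact hind'.hasLaw_prod h0 ⟨hVm, rfl⟩

theorem isExpectedZeroDensity (hab : IsStdGaussianCoeffs P a b) (K : ℂ) :
    IsExpectedZeroDensity P (randomSum (fun j z => z ^ (j : ℕ)) a b) K
      fun z => ∫ ω, kacRiceIntegrand K (tailCoeffs a b ω) z ∂P := by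
  have hV := hab.memLp_tailCoeffs
  have hVm : AEMeasurable (tailCoeffs a b) P :=
    aemeasurable_pi_iff.2 fun j => (hV j).aemeasurable
  have := hab.indep.isProbabilityMeasure
  have hlaw := hab.hasLaw_prod
  have hprob := Measure.isProbabilityMeasure_map (μ := P) hVm
  have hS : ∀ ω, randomSum (fun j z => z ^ (j : ℕ)) a b ω
      = fun z => ((a 0 ω : ℂ) + Complex.I * (b 0 ω : ℂ)) + tailPoly (tailCoeffs a b ω) z :=
    fun ω => funext fun z => randomSum_pow_eq a b ω z
  have hmeas : ∀ Φ : Set ℂ, IsCompact Φ → Measurable fun p : ℂ × (Fin N → ℂ) =>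
      levelCount (fun z => p.1 + tailPoly p.2 z) K Φ := fun Φ hΦ =>
    measurable_levelCount (F := fun (p : ℂ × (Fin N → ℂ)) z => p.1 + tailPoly p.2 z) (by
      unfold Function.uncurry
      exact (by fun_prop : Continuous fun q : (ℂ × (Fin N → ℂ)) × ℂ => q.1.1).add
        ((continuous_uncurry_tailPoly N).comp (by fun_prop :
          Continuous fun q : (ℂ × (Fin N → ℂ)) × ℂ => (q.1.2, q.2)))) K hΦ
  refine ⟨continuous_integral_kacRiceIntegrand hV K,
    fun z => integral_nonneg fun ω => kacRiceIntegrand_nonneg _ _ _, fun Φ hΦ => ?_,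
    fun Φ hΦ => ?_⟩
  · simp_rw [hS]
    have hcomp := (hmeas Φ hΦ).comp_aemeasurable hlaw.aemeasurable
    simpa only [Function.comp_def] using hcomp
  · simp_rw [hS]
    have hk : Measurable fun p : (Fin N → ℂ) × ℂ => ENNReal.ofReal (kacRiceIntegrand K p.1 p.2) :=
      (continuous_uncurry_kacRiceIntegrand K).measurable.ennreal_ofReal
    have hcomp := hlaw.lintegral_comp (hmeas Φ hΦ).aemeasurable
    dsimp only at hcomp
    calc _ = ∫⁻ p, levelCount (fun z => p.1 + tailPoly p.2 z) K Φ ∂((volume.withDensity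
            fun w => ENNReal.ofReal (stdComplexGaussianPDF w)).prod (P.map (tailCoeffs a b))) :=
          hcomp
      _ = ∫⁻ v, (∫⁻ z in Φ, ENNReal.ofReal (kacRiceIntegrand K v z)) ∂(P.map (tailCoeffs a b)) := by
          rw [lintegral_prod_symm' _ (hmeas Φ hΦ)]
          exact lintegral_congr fun v => lintegral_levelCount_add_tailPoly K v hΦ
      _ = ∫⁻ z in Φ, ∫⁻ v, ENNReal.ofReal (kacRiceIntegrand K v z) ∂(P.map (tailCoeffs a b)) :=
          lintegral_lintegral_swap hk.aemeasurable
      _ = _ := lintegral_congr fun z => by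
          have hkz : Measurable fun v : Fin N → ℂ => ENNReal.ofReal (kacRiceIntegrand K v z) := by
            simpa only [Function.comp_def] using hk.comp (measurable_prodMk_right (y := z))
          rw [lintegral_map' hkz.aemeasurable hVm,
            ofReal_integral_eq_lintegral_ofReal (integrable_kacRiceIntegrand hV K z)
              (.of_forall fun ω => kacRiceIntegrand_nonneg _ _ _)]

end IsStdGaussianCoeffs
end

/-! ### Evaluation at ±1 -/

theorem sum_fin_add_one (N : ℕ) : ∑ j : Fin N, (((j : ℕ) : ℝ) + 1) = (N : ℝ) * (N + 1) / 2 := by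
  rw [Fin.sum_univ_eq_sum_range fun j => ((j : ℝ) + 1)]
  induction N with
  | zero => simp
  | succ n ih =>
    rw [Finset.sum_range_succ, ih]
    push_cast
    ring

theorem sum_fin_add_one_sq (N : ℕ) :
    ∑ j : Fin N, (((j : ℕ) : ℝ) + 1) ^ 2 = (N : ℝ) * (N + 1) * (2 * N + 1) / 6 := by
  rw [Fin.sum_univ_eq_sum_range fun j : ℕ => ((j : ℝ) + 1) ^ 2]
  induction N with
  | zero => simp
  | succ n ih =>
    rw [Finset.sum_range_succ, ih]
    push_cast
    ring

theorem tailPoly_ofReal {Ω : Type*} {N : ℕ} (a b : Fin (N + 1) → Ω → ℝ) (ω : Ω) (ε : ℝ) :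
    tailPoly (tailCoeffs a b ω) ε = ⟨∑ j : Fin N, ε ^ ((j : ℕ) + 1) * a j.succ ω,
      ∑ j : Fin N, ε ^ ((j : ℕ) + 1) * b j.succ ω⟩ := by
  rw [Complex.mk_eq_add_mul_I, Complex.ofReal_sum, Complex.ofReal_sum, Finset.sum_mul,
    ← Finset.sum_add_distrib]
  refine Finset.sum_congr rfl fun j _ => ?_
  simp only [tailCoeffs]
  push_cast
  ring

theorem tailPolyDeriv_ofReal {Ω : Type*} {N : ℕ} (a b : Fin (N + 1) → Ω → ℝ) (ω : Ω) (ε : ℝ) :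
    tailPolyDeriv (tailCoeffs a b ω) ε
      = ⟨∑ j : Fin N, (((j : ℕ) : ℝ) + 1) * ε ^ (j : ℕ) * a j.succ ω,
        ∑ j : Fin N, (((j : ℕ) : ℝ) + 1) * ε ^ (j : ℕ) * b j.succ ω⟩ := by
  rw [Complex.mk_eq_add_mul_I, Complex.ofReal_sum, Complex.ofReal_sum, Finset.sum_mul,
    ← Finset.sum_add_distrib]
  refine Finset.sum_congr rfl fun j _ => ?_
  simp only [tailCoeffs]
  push_cast
  ring

namespace IsStdGaussianCoeffs

variable {Ω : Type*} [MeasurableSpace Ω] {P : Measure Ω} {N : ℕ} {a b : Fin (N + 1) → Ω → ℝ}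

theorem iIndepFun_tail_re (hab : IsStdGaussianCoeffs P a b) :
    iIndepFun (fun j : Fin N => a j.succ) P :=
  hab.indep.precomp (g := fun j : Fin N => Sum.inl j.succ)
    (Sum.inl_injective.comp (Fin.succ_injective N))

theorem iIndepFun_tail_im (hab : IsStdGaussianCoeffs P a b) :
    iIndepFun (fun j : Fin N => b j.succ) P :=
  hab.indep.precomp (g := fun j : Fin N => Sum.inr j.succ)
    (Sum.inr_injective.comp (Fin.succ_injective N))

theorem indepFun_tail (hab : IsStdGaussianCoeffs P a b) :
    IndepFun (fun ω (j : Fin N) => a j.succ ω) (fun ω (j : Fin N) => b j.succ ω) P :=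
  hab.indep.indepFun_reindex hab.aemeasurable_elim (fun j : Fin N => Sum.inl j.succ)
    (fun j : Fin N => Sum.inr j.succ) (by simp)

/-- The expected density of zeros at a real point `ε` with `ε ^ 2 = 1`. -/
theorem integral_kacRiceIntegrand_of_sq_eq_one (hab : IsStdGaussianCoeffs P a b) (K : ℂ) {ε : ℝ}
    (hε : ε ^ 2 = 1) :
    ∫ ω, kacRiceIntegrand K (tailCoeffs a b ω) ε ∂P
      = 1 / (12 * Real.pi) * Real.exp (-(K.re ^ 2 + K.im ^ 2) / (2 * (N : ℝ) + 2)) *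
        (2 * (N : ℝ) + (N : ℝ) ^ 2 * (1 + 3 * (K.re ^ 2 + K.im ^ 2) / (2 * (N : ℝ) + 2))) := by
  -- For `N = 0` the tail is empty and both sides vanish; otherwise its real and imaginary parts
  -- have nonzero variance `N`, as the Gaussian lemmas require.
  rcases N.eq_zero_or_pos with rfl | hN
  · simp [kacRiceIntegrand, tailPolyDeriv]
  have hN0 : (N : NNReal) ≠ 0 := by exact_mod_cast hN.ne'
  set α : Fin N → ℝ := fun j => ε ^ ((j : ℕ) + 1) with hα
  set β : Fin N → ℝ := fun j => (((j : ℕ) : ℝ) + 1) * ε ^ (j : ℕ) with hβ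
  have hα2 : (((N : NNReal) : ℝ)) = ∑ j, α j ^ 2 := by
    have h1 : ∀ j, α j ^ 2 = 1 := fun j => by
      simp only [hα]
      rw [pow_right_comm, hε, one_pow]
    simp [h1]
  have hβ2 : ∑ j, β j ^ 2 = N * (N + 1) * (2 * N + 1) / 6 := by
    rw [← sum_fin_add_one_sq]
    refine Finset.sum_congr rfl fun j _ => ?_
    simp only [hβ]
    rw [mul_pow, pow_right_comm, hε, one_pow, mul_one]
  -- The covariance carries a factor `ε`, but only its square enters, so 1 and −1 give the same
  -- value.
  have hαβ : (∑ j, α j * β j) ^ 2 = (N * (N + 1) / 2) ^ 2 := by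
    have h1 : ∀ j, α j * β j = ε * (((j : ℕ) : ℝ) + 1) := fun j => by
      calc α j * β j = ε * (((j : ℕ) : ℝ) + 1) * (ε ^ 2) ^ (j : ℕ) := by
            simp only [hα, hβ]; ring
        _ = _ := by rw [hε, one_pow, mul_one]
    simp_rw [h1]
    rw [← Finset.mul_sum, sum_fin_add_one, mul_pow, hε, one_mul]
  have hla : ∀ j : Fin N, HasLaw (a j.succ) (gaussianReal 0 1) P := fun j => hab.law_a _
  have hlb : ∀ j : Fin N, HasLaw (b j.succ) (gaussianReal 0 1) P := fun j => hab.law_b _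
  have hia := hab.iIndepFun_tail_re
  have hib := hab.iIndepFun_tail_im
  have hind := hab.indepFun_tail
  have hXa := hasGaussianLaw_sum_prod hla hia α β
  have hXb := hasGaussianLaw_sum_prod hlb hib α β
  set X := fun ω => ∑ j : Fin N, α j * a j.succ ω with hX
  set X' := fun ω => ∑ j : Fin N, β j * a j.succ ω with hX'
  set Y := fun ω => ∑ j : Fin N, α j * b j.succ ω with hY
  set Y' := fun ω => ∑ j : Fin N, β j * b j.succ ω with hY'
  set g := gaussianPDFReal 0 1 with hg
  have hgm : Measurable g := measurable_gaussianPDFReal 0 1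
  -- Expanding |T'|² = X'² + Y'² leaves two products, each of a function of the `a j` and a function
  -- of the `b j`.
  have hexp : ∀ ω, kacRiceIntegrand K (tailCoeffs a b ω) ε
      = (g (K.re - X ω) * X' ω ^ 2) * g (K.im - Y ω)
        + g (K.re - X ω) * (g (K.im - Y ω) * Y' ω ^ 2) := by
    intro ω
    rw [kacRiceIntegrand, tailPoly_ofReal, tailPolyDeriv_ofReal, ← Complex.normSq_eq_norm_sq,
      Complex.normSq_mk, stdComplexGaussianPDF, Complex.sub_re, Complex.sub_im]
    ring
  have hind1 : IndepFun (fun ω => g (K.re - X ω) * X' ω ^ 2) (fun ω => g (K.im - Y ω)) P :=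
    hind.comp
      (φ := fun x : Fin N → ℝ => g (K.re - ∑ j, α j * x j) * (∑ j, β j * x j) ^ 2)
      (ψ := fun x : Fin N → ℝ => g (K.im - ∑ j, α j * x j)) (by fun_prop) (by fun_prop)
  have hind2 : IndepFun (fun ω => g (K.re - X ω)) (fun ω => g (K.im - Y ω) * Y' ω ^ 2) P :=
    hind.comp (φ := fun x : Fin N → ℝ => g (K.re - ∑ j, α j * x j))
      (ψ := fun x : Fin N → ℝ => g (K.im - ∑ j, α j * x j) * (∑ j, β j * x j) ^ 2)
      (by fun_prop) (by fun_prop)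
  have := hab.indep.isProbabilityMeasure
  have hXm : AEMeasurable X P := hXa.fst.aemeasurable
  have hYm : AEMeasurable Y P := hXb.fst.aemeasurable
  have hgX : Integrable (fun ω => g (K.re - X ω)) P := by
    simpa using integrable_bounded_gaussian_mul hXm K.re (integrable_const (1 : ℝ))
  have hgY : Integrable (fun ω => g (K.im - Y ω)) P := by
    simpa using integrable_bounded_gaussian_mul hYm K.im (integrable_const (1 : ℝ))
  have hgX' : Integrable (fun ω => g (K.re - X ω) * X' ω ^ 2) P :=
    integrable_bounded_gaussian_mul hXm K.re hXa.snd.memLp_two.integrable_sq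
  have hgY' : Integrable (fun ω => g (K.im - Y ω) * Y' ω ^ 2) P :=
    integrable_bounded_gaussian_mul hYm K.im hXb.snd.memLp_two.integrable_sq
  have hI1 : Integrable (fun ω => g (K.re - X ω) * X' ω ^ 2 * g (K.im - Y ω)) P :=
    hind1.integrable_mul hgX' hgY
  have hI2 : Integrable (fun ω => g (K.re - X ω) * (g (K.im - Y ω) * Y' ω ^ 2)) P :=
    hind2.integrable_mul hgX hgY'
  rw [integral_congr_ae (.of_forall hexp), integral_add hI1 hI2,
    hind1.integral_fun_mul_eq_mul_integral hgX'.aestronglyMeasurable hgY.aestronglyMeasurable,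
    hind2.integral_fun_mul_eq_mul_integral hgX.aestronglyMeasurable hgY'.aestronglyMeasurable,
    integral_gaussianPDFReal_sub hN0 (hasLaw_sum_gaussian hla hia α hα2),
    integral_gaussianPDFReal_sub hN0 (hasLaw_sum_gaussian hlb hib α hα2),
    integral_gaussianPDFReal_sub_mul_sq hla hia α β hN0 hα2,
    integral_gaussianPDFReal_sub_mul_sq hlb hib α β hN0 hα2, hβ2, hαβ]
  have hp : gaussianPDFReal 0 (1 + (N : NNReal)) K.re * gaussianPDFReal 0 (1 + (N : NNReal)) K.im
      = 1 / (2 * Real.pi * (1 + N))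
        * Real.exp (-(K.re ^ 2 + K.im ^ 2) / (2 * (N : ℝ) + 2)) := by
    simp only [gaussianPDFReal, NNReal.coe_add, NNReal.coe_one, NNReal.coe_natCast, sub_zero]
    rw [mul_mul_mul_comm, ← mul_inv, Real.mul_self_sqrt (by positivity), ← Real.exp_add, one_div]
    congr 2
    field_simp
    ring
  simp only [NNReal.coe_natCast]
  rw [← mul_assoc (gaussianPDFReal _ _ _) (gaussianPDFReal _ _ _),
    mul_right_comm (gaussianPDFReal _ _ _) _ (gaussianPDFReal _ _ _), hp]
  field_simp
  ring

end IsStdGaussianCoeffs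

theorem IsExpectedZeroDensity.apply_of_eq_one_or_eq_neg_one {Ω : Type*} [MeasurableSpace Ω]
    {P : Measure Ω} {N : ℕ} {a b : Fin (N + 1) → Ω → ℝ} (hab : IsStdGaussianCoeffs P a b) {K : ℂ}
    {h : ℂ → ℝ} (H : IsExpectedZeroDensity P (randomSum (fun j z => z ^ (j : ℕ)) a b) K h) {z : ℂ}
    (hz : z = 1 ∨ z = -1) :
    h z = 1 / (12 * Real.pi) * Real.exp (-(K.re ^ 2 + K.im ^ 2) / (2 * (N : ℝ) + 2)) *
        (2 * (N : ℝ) + (N : ℝ) ^ 2 * (1 + 3 * (K.re ^ 2 + K.im ^ 2) / (2 * (N : ℝ) + 2))) := by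
  rw [H.unique (hab.isExpectedZeroDensity K)]
  rcases hz with rfl | rfl
  · simpa using hab.integral_kacRiceIntegrand_of_sq_eq_one K (ε := 1) (by norm_num)
  · simpa using hab.integral_kacRiceIntegrand_of_sq_eq_one K (ε := -1) (by norm_num)

theorem theorem6 {Ω : Type*} [MeasurableSpace Ω] (P : Measure Ω) [IsProbabilityMeasure P]
    (N : ℕ) (a b : Fin (N + 1) → Ω → ℝ) (hab : IsStdGaussianCoeffs P a b) :
    -- the density exists and is unique, for every level
    (∀ K₁ K₂ : ℝ, ∃! h : ℂ → ℝ,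
      IsExpectedZeroDensity P (randomSum (fun j z => z ^ (j : ℕ)) a b) ⟨K₁, K₂⟩ h) ∧
    -- its values at `1` and `-1` for a general level
    (∀ (K₁ K₂ : ℝ) (h : ℂ → ℝ),
      IsExpectedZeroDensity P (randomSum (fun j z => z ^ (j : ℕ)) a b) ⟨K₁, K₂⟩ h →
      ∀ z : ℂ, z = 1 ∨ z = -1 →
        h z = 1 / (12 * Real.pi) * Real.exp (-(K₁ ^ 2 + K₂ ^ 2) / (2 * (N : ℝ) + 2)) *
          (2 * (N : ℝ) + (N : ℝ) ^ 2 * (1 + 3 * (K₁ ^ 2 + K₂ ^ 2) / (2 * (N : ℝ) + 2)))) ∧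
    -- levels with `K₁² + K₂² = 2 K²`, for instance `K₁ = K₂ = K`
    (∀ (K K₁ K₂ : ℝ) (h : ℂ → ℝ), 0 < K → K₁ ^ 2 + K₂ ^ 2 = 2 * K ^ 2 →
      IsExpectedZeroDensity P (randomSum (fun j z => z ^ (j : ℕ)) a b) ⟨K₁, K₂⟩ h →
      ∀ z : ℂ, z = 1 ∨ z = -1 →
        h z = 1 / (12 * Real.pi) * Real.exp (-K ^ 2 / ((N : ℝ) + 1)) *
          (2 * (N : ℝ) + (N : ℝ) ^ 2 * (1 + 3 * K ^ 2 / ((N : ℝ) + 1)))) ∧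
    -- level zero
    (∀ h : ℂ → ℝ,
      IsExpectedZeroDensity P (randomSum (fun j z => z ^ (j : ℕ)) a b) 0 h →
      ∀ z : ℂ, z = 1 ∨ z = -1 →
        h z = 1 / (12 * Real.pi) * ((N : ℝ) * ((N : ℝ) + 2))) := by
  refine ⟨fun K₁ K₂ => ⟨_, hab.isExpectedZeroDensity _, fun h H =>
    H.unique (hab.isExpectedZeroDensity _)⟩, fun K₁ K₂ h H z hz =>
      H.apply_of_eq_one_or_eq_neg_one hab hz, fun K K₁ K₂ h _ hK H z hz => ?_, fun h H z hz => ?_⟩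
  · rw [H.apply_of_eq_one_or_eq_neg_one hab hz, hK]
    have hN : (N : ℝ) + 1 ≠ 0 := by positivity
    have h1 : -(2 * K ^ 2) / (2 * (N : ℝ) + 2) = -K ^ 2 / ((N : ℝ) + 1) := by
      field_simp
    have h2 : 3 * (2 * K ^ 2) / (2 * (N : ℝ) + 2) = 3 * K ^ 2 / ((N : ℝ) + 1) := by
      field_simp
    rw [h1, h2]
  · rw [H.apply_of_eq_one_or_eq_neg_one hab hz]
    simp
    ring
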